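/- For a non-negative integer $k$ let $(a;q)_0=1$ and $(a;q)_k=(1-a)(1-aq)\cdots(1-aq^{k-1})$ for $k\ge 1$, and let $\Phi_n(q)$ denote the $n$-th cyclotomic polynomial. For a polynomial $P(q)\in\mathbb{Q}[q]$ and a rational function $f(q)\in\mathbb{Q}(q)$, write $f(q)\equiv 0\pmod{P(q)}$ if the numerator of $f(q)$, written in lowest terms, is divisible by $P(q)$ in $\mathbb{Q}[q]$. **Theorem.** Let $m$ and $n$ be positive integers with $n\equiv 3\pmod 4$. Then $$\sum_{k=0}^{mn-1}\frac{(1+q^{4k+1})(q^2;q^4)_k^3}{(1+q)(q^4;q^4)_k^3}\,q^k\equiv 0\pmod{\Phi_n(q)^2},$$ $$\sum_{k=0}^{mn+(n-1)/2}\frac{(1+q^{4k+1})(q^2;q^4)_k^3}{(1+q)(q^4;q^4)_k^3}\,q^k\equiv 0\pmod{\Phi_n(q)^2}.$$ -/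

import Mathlib

/-- The `q`-shifted factorial `(a; q)_n = (1 - a) (1 - a q) ⋯ (1 - a q ^ (n - 1))`,
with `(a; q)_0 = 1`. -/
def qShiftedFactorial {R : Type*} [CommRing R] (a q : R) (n : ℕ) : R :=
  ∏ i ∈ Finset.range n, (1 - a * q ^ i)

/-- Congruence of two rational functions in `q` with rational coefficients modulo a polynomial `P`:
the numerator of `f - g`, written in lowest terms, is divisible by `P`
(so the denominator is then automatically coprime to `P`). -/
def RatFuncModEq (P : Polynomial ℚ) (f g : RatFunc ℚ) : Prop :=
  P ∣ (f - g).num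

/-- The summand `(1 + q ^ (4k+1)) (q²; q⁴)_k ³ q ^ k / ((1 + q) (q⁴; q⁴)_k ³)`,
as a rational function in the indeterminate `q = RatFunc.X`. -/
noncomputable def summand (k : ℕ) : RatFunc ℚ :=
  let q : RatFunc ℚ := RatFunc.X
  ((1 + q ^ (4 * k + 1)) * qShiftedFactorial (q ^ 2) (q ^ 4) k ^ 3) /
    ((1 + q) * qShiftedFactorial (q ^ 4) (q ^ 4) k ^ 3) * q ^ k

/-! Write `n = 4s + 3` and `y = q ^ n`, and measure divisibility by the `Φ_n`-adic valuation of
`ℚ(q)`: for `e ≠ 0`, `1 - q ^ e` has valuation `ε` if `n ∣ e` and `1` otherwise. Cut the sum into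
blocks `k = n t + j` with `0 ≤ j < n`. The ratio of shifted factorials is a unit at the start of
each block, and for `j > 2s + 1` its cube keeps an uncancelled factor `(1 - q ^ (4nt + 2n)) ^ 3`, so
those terms are negligible. There remain the half blocks `j ≤ 2s + 1`.

In a half block each cube has the form `(1 - x u) ^ 3` with `x = y ^ (4t)`. Replace it by `(1 - α u)
(1 - β u) (1 - γ u)`, where `α`, `β`, `γ` are powers of `y` with `α β γ = x ^ 3`. All four are `1`
modulo `Φ_n`, so the error is `O(Φ_n ^ 2)` (`Valuation.map_prod_three_sub_cube_le`). The exponents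
are chosen to make the perturbed half block a terminating very-well-poised `₆φ₅` series in base `q ^
4`. Its product evaluation (`wellPoised_sum`) has two numerator factors divisible by `Φ_n` and a
denominator prime to `Φ_n`, so every half block vanishes to second order. The first sum consists of
full blocks; the second has one extra half block. -/

/-! ### The terminating `₆φ₅` summation, by creative telescoping. -/

section WellPoised

variable {K : Type*} [Field K]

/-- The coefficient of `1 - A p ^ (2k)` in the `k`-th term of the terminating very-well-poised
`₆φ₅` series in base `p`, with `A = e b d` and with `p ^ (-N)` as the terminating parameter. -/
def wellPoisedCoeff (e b d p : K) (N k : ℕ) : K :=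
  ∏ i ∈ Finset.range k,
    ((1 - e * b * d * p ^ i) * (1 - b * p ^ i) * (1 - d * p ^ i) * (p ^ N - p ^ i) * (e * p)) /
      ((1 - p ^ (i + 1)) * (1 - e * d * p ^ (i + 1)) * (1 - e * b * p ^ (i + 1)) *
        (1 - e * b * d * p ^ (N + 1 + i)))

theorem wellPoisedCoeff_eq_zero (e b d p : K) {N k : ℕ} (h : N < k) :
    wellPoisedCoeff e b d p N k = 0 :=
  Finset.prod_eq_zero (Finset.mem_range.2 h) (by simp)

theorem wellPoisedCoeff_succ (e b d p : K) (N k : ℕ) :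
    wellPoisedCoeff e b d p N (k + 1) = wellPoisedCoeff e b d p N k *
      (((1 - e * b * d * p ^ k) * (1 - b * p ^ k) * (1 - d * p ^ k) * (p ^ N - p ^ k) * (e * p)) /
        ((1 - p ^ (k + 1)) * (1 - e * d * p ^ (k + 1)) * (1 - e * b * p ^ (k + 1)) *
          (1 - e * b * d * p ^ (N + 1 + k)))) :=
  Finset.prod_range_succ _ _

/-- Only `p ^ N - p ^ i` and `1 - e b d p ^ (N + 1 + i)` depend on `N`, and their ratios telescope
in `i` up to powers of `p`. The cross-multiplied form survives at `k = N + 1`, where both sides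
vanish. -/
theorem wellPoisedCoeff_succ_left {e b d p : K}
    (hA : ∀ i : ℕ, 1 - e * b * d * p ^ (i + 1) ≠ 0) (N k : ℕ) :
    wellPoisedCoeff e b d p N k *
        (p ^ k * (p ^ (N + 1) - 1) * (1 - e * b * d * p ^ (N + 1))) =
      wellPoisedCoeff e b d p (N + 1) k *
        ((p ^ (N + 1) - p ^ k) * (1 - e * b * d * p ^ (N + 1 + k))) := by
  induction k with
  | zero => simp [wellPoisedCoeff]
  | succ k ih =>
    have h1 : 1 - e * b * d * p ^ (N + 1 + k) ≠ 0 := by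
      have := hA (N + k); rwa [show N + k + 1 = N + 1 + k by ring] at this
    have h2 : 1 - e * b * d * p ^ (N + 1 + 1 + k) ≠ 0 := by
      have := hA (N + k + 1); rwa [show N + k + 1 + 1 = N + 1 + 1 + k by ring] at this
    rw [wellPoisedCoeff_succ, wellPoisedCoeff_succ]
    have e1 : ∀ Q D, (1 - e * b * d * p ^ k) * (1 - b * p ^ k) * (1 - d * p ^ k) * (Q - p ^ k) *
        (e * p) / ((1 - p ^ (k + 1)) * (1 - e * d * p ^ (k + 1)) * (1 - e * b * p ^ (k + 1)) * D) =
        (1 - e * b * d * p ^ k) * (1 - b * p ^ k) * (1 - d * p ^ k) * (e * p) /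
          ((1 - p ^ (k + 1)) * (1 - e * d * p ^ (k + 1)) * (1 - e * b * p ^ (k + 1))) *
            ((Q - p ^ k) / D) := fun Q D => by
      rw [div_mul_div_comm, mul_right_comm _ (Q - p ^ k)]
    rw [e1, e1]
    generalize (1 - e * b * d * p ^ k) * (1 - b * p ^ k) * (1 - d * p ^ k) * (e * p) /
      ((1 - p ^ (k + 1)) * (1 - e * d * p ^ (k + 1)) * (1 - e * b * p ^ (k + 1))) = r
    generalize wellPoisedCoeff e b d p N k = X at *
    generalize wellPoisedCoeff e b d p (N + 1) k = X' at *
    rw [show N + 1 + (k + 1) = N + 1 + 1 + k by ring]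
    have e2 : X * (r * ((p ^ N - p ^ k) / (1 - e * b * d * p ^ (N + 1 + k)))) *
        (p ^ (k + 1) * (p ^ (N + 1) - 1) * (1 - e * b * d * p ^ (N + 1))) =
      (X * (p ^ k * (p ^ (N + 1) - 1) * (1 - e * b * d * p ^ (N + 1)))) * r * p *
        ((p ^ N - p ^ k) / (1 - e * b * d * p ^ (N + 1 + k))) := by ring
    rw [e2, ih]
    field_simp
    ring

/-- The polynomial identity behind the induction step of `wellPoised_telescope`, with `w = p ^ (N +
1)` and `Y = p ^ k`. -/
theorem wellPoised_certificate (e b d w Y : K) :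
    (1 - e * b * d * Y ^ 2) * ((1 - e * d * w) * (1 - e * b * w) * Y * (w - 1) -
        (1 - e * w) * (w - Y) * (1 - e * b * d * w * Y)) =
      w * ((1 - e * b * d * Y) * (1 - b * Y) * (1 - d * Y) * (w - Y) * e -
        (1 - Y) * (1 - e * d * Y) * (1 - e * b * Y) * (1 - e * b * d * w * Y)) := by
  ring

/-- The first-order recurrence in `N` for the `₆φ₅` sum, written termwise as a difference in `k`.
The right side is the antidifference; it vanishes at `k = 0` and for `k > N + 1`. -/
theorem wellPoised_telescope {e b d p : K} (hp0 : p ≠ 0) (hp : ∀ i : ℕ, 1 - p ^ (i + 1) ≠ 0)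
    (hb : ∀ i : ℕ, 1 - e * d * p ^ (i + 1) ≠ 0) (hd : ∀ i : ℕ, 1 - e * b * p ^ (i + 1) ≠ 0)
    (hA : ∀ i : ℕ, 1 - e * b * d * p ^ (i + 1) ≠ 0) (N k : ℕ) :
    (p ^ (N + 1) - 1) * ∑ j ∈ Finset.range k, (1 - e * b * d * (p ^ j) ^ 2) *
        ((1 - e * d * p ^ (N + 1)) * (1 - e * b * p ^ (N + 1)) *
            wellPoisedCoeff e b d p (N + 1) j -
          (1 - e * b * d * p ^ (N + 1)) * (1 - e * p ^ (N + 1)) * wellPoisedCoeff e b d p N j) =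
      p ^ (N + 1) * ((1 - p ^ k) * (1 - e * d * p ^ k) * (1 - e * b * p ^ k) *
        (1 - e * b * d * p ^ (N + 1 + k)) / p ^ k) * wellPoisedCoeff e b d p (N + 1) k := by
  induction k with
  | zero => simp
  | succ k ih =>
    have hY : p ^ k ≠ 0 := pow_ne_zero _ hp0
    have h1 := hp k
    have h2 := hb k
    have h3 := hd k
    have h4 : 1 - e * b * d * p ^ (N + 1 + 1 + k) ≠ 0 := by
      have := hA (N + k + 1); rwa [show N + k + 1 + 1 = N + 1 + 1 + k by ring] at this
    have hs := wellPoisedCoeff_succ_left hA N k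
    have hn : wellPoisedCoeff e b d p (N + 1) (k + 1) * ((1 - p ^ (k + 1)) *
        (1 - e * d * p ^ (k + 1)) * (1 - e * b * p ^ (k + 1)) *
          (1 - e * b * d * p ^ (N + 1 + 1 + k))) = wellPoisedCoeff e b d p (N + 1) k *
        ((1 - e * b * d * p ^ k) * (1 - b * p ^ k) * (1 - d * p ^ k) * (p ^ (N + 1) - p ^ k) *
          (e * p)) := by
      rw [wellPoisedCoeff_succ, mul_assoc,
        div_mul_cancel₀ _ (mul_ne_zero (mul_ne_zero (mul_ne_zero h1 h2) h3) h4)]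
    have hc := wellPoised_certificate e b d (p ^ (N + 1)) (p ^ k)
    rw [Finset.sum_range_succ, mul_add, ih]
    generalize wellPoisedCoeff e b d p (N + 1) (k + 1) = H' at *
    generalize wellPoisedCoeff e b d p (N + 1) k = H at *
    generalize wellPoisedCoeff e b d p N k = G at *
    rw [show N + 1 + (k + 1) = N + 1 + 1 + k by ring]
    have e1 : p ^ (N + 1) * ((1 - p ^ (k + 1)) * (1 - e * d * p ^ (k + 1)) *
        (1 - e * b * p ^ (k + 1)) * (1 - e * b * d * p ^ (N + 1 + 1 + k)) / p ^ (k + 1)) * H' =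
        p ^ (N + 1) * (H * ((1 - e * b * d * p ^ k) * (1 - b * p ^ k) * (1 - d * p ^ k) *
          (p ^ (N + 1) - p ^ k) * (e * p))) / p ^ (k + 1) := by rw [← hn]; ring
    rw [e1, pow_add p (N + 1) k, pow_succ p k] at *
    generalize p ^ (N + 1) = w at *
    generalize p ^ k = Y at *
    field_simp
    linear_combination H * hc - (1 - e * b * d * Y ^ 2) * (1 - e * w) * hs

/-- The terminating `₆φ₅` summation formula. -/
theorem wellPoised_sum {e b d p : K} (hp0 : p ≠ 0) (hp : ∀ i : ℕ, 1 - p ^ (i + 1) ≠ 0)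
    (hb : ∀ i : ℕ, 1 - e * d * p ^ (i + 1) ≠ 0) (hd : ∀ i : ℕ, 1 - e * b * p ^ (i + 1) ≠ 0)
    (hA : ∀ i : ℕ, 1 - e * b * d * p ^ (i + 1) ≠ 0) (N : ℕ) :
    ∑ j ∈ Finset.range (N + 1), (1 - e * b * d * (p ^ j) ^ 2) * wellPoisedCoeff e b d p N j =
      (1 - e * b * d) * ∏ i ∈ Finset.range N,
        ((1 - e * b * d * p ^ (i + 1)) * (1 - e * p ^ (i + 1)) /
          ((1 - e * d * p ^ (i + 1)) * (1 - e * b * p ^ (i + 1)))) := by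
  induction N with
  | zero => simp [wellPoisedCoeff]
  | succ N ih =>
    -- `N + 2` terms exhaust both series, so the boundary term is zero.
    have h := wellPoised_telescope hp0 hp hb hd hA N (N + 2)
    rw [wellPoisedCoeff_eq_zero e b d p (show N + 1 < N + 2 by omega), mul_zero] at h
    have h0 : p ^ (N + 1) - 1 ≠ 0 := fun h' => hp N (by linear_combination -h')
    have h := (mul_eq_zero.1 h).resolve_left h0
    have e1 : ∑ j ∈ Finset.range (N + 2), (1 - e * b * d * (p ^ j) ^ 2) *
        wellPoisedCoeff e b d p N j = (1 - e * b * d) * ∏ i ∈ Finset.range N,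
        ((1 - e * b * d * p ^ (i + 1)) * (1 - e * p ^ (i + 1)) /
          ((1 - e * d * p ^ (i + 1)) * (1 - e * b * p ^ (i + 1)))) := by
      rw [Finset.sum_range_succ, ih, wellPoisedCoeff_eq_zero e b d p (show N < N + 1 by omega)]
      ring
    simp only [mul_sub, Finset.sum_sub_distrib] at h
    simp only [mul_left_comm (1 - e * b * d * (p ^ _) ^ 2), ← Finset.mul_sum] at h
    rw [e1] at h
    rw [Finset.prod_range_succ]
    have hb' := hb N
    have hd' := hd N
    rw [← mul_assoc, mul_div_assoc', eq_div_iff (mul_ne_zero hb' hd')]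
    linear_combination h

end WellPoised

/-! ### Ultrametric estimates for products and quotients. -/

section Valuation

variable {K Γ₀ : Type*} [Field K] [LinearOrderedCommGroupWithZero Γ₀] {v : Valuation K Γ₀}

theorem Valuation.map_mul_sub_mul_le {a b c d : K} {r : Γ₀} (ha : v a ≤ 1) (hd : v d ≤ 1)
    (h : v (a - c) ≤ r) (h' : v (b - d) ≤ r) : v (a * b - c * d) ≤ r := by
  rw [show a * b - c * d = a * (b - d) + (a - c) * d by ring]
  refine v.map_add_le ?_ ?_ <;> rw [map_mul]
  · exact mul_le_of_le_one_of_le ha h'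
  · exact mul_le_of_le_of_le_one h hd

theorem Valuation.map_div_sub_div_le {a b c d : K} {r : Γ₀} (ha : v a ≤ 1) (hb : v b = 1)
    (hd : v d = 1) (h : v (a - c) ≤ r) (h' : v (b - d) ≤ r) : v (a / b - c / d) ≤ r := by
  have hb0 : b ≠ 0 := by rintro rfl; simp at hb
  have hd0 : d ≠ 0 := by rintro rfl; simp at hd
  rw [div_sub_div _ _ hb0 hd0, map_div₀, map_mul, hb, hd, mul_one, div_one]
  rw [show a * d - b * c = (a - c) * b - a * (b - d) by ring]
  refine v.map_sub_le ?_ ?_ <;> rw [map_mul]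
  · exact mul_le_of_le_of_le_one h hb.le
  · exact mul_le_of_le_one_of_le ha h'

theorem Valuation.map_prod_le_one {ι : Type*} {s : Finset ι} {f : ι → K}
    (hf : ∀ i ∈ s, v (f i) ≤ 1) : v (∏ i ∈ s, f i) ≤ 1 := by
  rw [map_prod]
  exact Finset.prod_le_one' hf

theorem Valuation.map_prod_le_of_mem {ι : Type*} {s : Finset ι} {f : ι → K} {r : Γ₀}
    (hf : ∀ i ∈ s, v (f i) ≤ 1) {j : ι} (hj : j ∈ s) (h : v (f j) ≤ r) :
    v (∏ i ∈ s, f i) ≤ r := by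
  classical
  rw [← Finset.mul_prod_erase s f hj, map_mul]
  exact mul_le_of_le_of_le_one h
    (Valuation.map_prod_le_one fun i hi => hf i (Finset.mem_of_mem_erase hi))

theorem Valuation.map_prod_sub_prod_le {f g : ℕ → K} {r : Γ₀} {k : ℕ}
    (hf : ∀ i < k, v (f i) ≤ 1) (hg : ∀ i < k, v (g i) ≤ 1) (h : ∀ i < k, v (f i - g i) ≤ r) :
    v (∏ i ∈ Finset.range k, f i - ∏ i ∈ Finset.range k, g i) ≤ r := by
  induction k with
  | zero => simp
  | succ k ih =>
    rw [Finset.prod_range_succ, Finset.prod_range_succ]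
    exact Valuation.map_mul_sub_mul_le
      (Valuation.map_prod_le_one fun i hi => hf i ((Finset.mem_range.1 hi).trans k.lt_succ_self))
      (hg k k.lt_succ_self)
      (ih (fun i hi => hf i (hi.trans k.lt_succ_self)) (fun i hi => hg i (hi.trans k.lt_succ_self))
        fun i hi => h i (hi.trans k.lt_succ_self)) (h k k.lt_succ_self)

theorem Valuation.map_one_sub_le_one {a : K} (h : v a ≤ 1) : v (1 - a) ≤ 1 :=
  v.map_sub_le v.map_one.le h

/-- If `α`, `β`, `γ`, `x` are close to `1` and `α β γ = x ^ 3`, then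
`(1 - α u) (1 - β u) (1 - γ u)` agrees with `(1 - x u) ^ 3` to second order. -/
theorem Valuation.map_prod_three_sub_cube_le {α β γ x u : K} {ε : Γ₀} (hε : ε ≤ 1)
    (hα : v (1 - α) ≤ ε) (hβ : v (1 - β) ≤ ε) (hγ : v (1 - γ) ≤ ε) (hx : v (1 - x) ≤ ε)
    (hu : v u ≤ 1) (h : α * β * γ = x ^ 3) :
    v ((1 - α * u) * (1 - β * u) * (1 - γ * u) - (1 - x * u) ^ 3) ≤ ε ^ 2 := by
  obtain ⟨a, rfl⟩ : ∃ a, α = 1 - a := ⟨1 - α, by ring⟩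
  obtain ⟨b, rfl⟩ : ∃ b, β = 1 - b := ⟨1 - β, by ring⟩
  obtain ⟨c, rfl⟩ : ∃ c, γ = 1 - c := ⟨1 - γ, by ring⟩
  obtain ⟨d, rfl⟩ : ∃ d, x = 1 - d := ⟨1 - x, by ring⟩
  simp only [sub_sub_cancel] at hα hβ hγ hx
  have hmul : ∀ {y z : K}, v y ≤ ε → v z ≤ ε → v (y * z) ≤ ε ^ 2 := fun hy hz => by
    rw [map_mul, sq]; exact mul_le_mul' hy hz
  have hmul1 : ∀ {y z : K} {r : Γ₀}, v y ≤ r → v z ≤ 1 → v (y * z) ≤ r := fun hy hz => by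
    rw [map_mul]; exact mul_le_of_le_of_le_one hy hz
  have hd2 := hmul hx hx
  have h2 : v (a * b + b * c + c * a - (d * d + d * d + d * d)) ≤ ε ^ 2 :=
    v.map_sub_le (v.map_add_le (v.map_add_le (hmul hα hβ) (hmul hβ hγ)) (hmul hγ hα))
      (v.map_add_le (v.map_add_le hd2 hd2) hd2)
  have h3 : v (a * b * c - d * d * d) ≤ ε ^ 2 :=
    v.map_sub_le (hmul1 (hmul hα hβ) (hγ.trans hε)) (hmul1 hd2 (hx.trans hε))
  have hu' := Valuation.map_one_sub_le_one hu
  -- The hypothesis `h` eliminates the linear part `a + b + c - 3 d`, leaving only terms of order at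
  -- least two.
  have key : (1 - (1 - a) * u) * (1 - (1 - b) * u) * (1 - (1 - c) * u) - (1 - (1 - d) * u) ^ 3 =
      (a * b + b * c + c * a - (d * d + d * d + d * d)) * ((1 - u) * u) -
        (a * b * c - d * d * d) * (u * ((1 - u) * (1 - u) - u * u)) := by
    linear_combination (- u * (1 - u) ^ 2) * h
  rw [key]
  have huu : ∀ {y z : K}, v y ≤ 1 → v z ≤ 1 → v (y * z) ≤ 1 := fun hy hz => hmul1 hy hz
  exact v.map_sub_le (hmul1 h2 (huu hu' hu))
    (hmul1 h3 (huu hu (v.map_sub_le (huu hu' hu') (huu hu hu))))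

end Valuation

/-! ### Valuations modelled on the place `Φ_n`. -/

section CyclotomicPlace

variable {K Γ₀ : Type*} [Field K] [LinearOrderedCommGroupWithZero Γ₀]

/-- The element `q` behaves at `v` like the indeterminate at the place of `ℚ(q)` given by the
`n`-th cyclotomic polynomial, whose uniformizers have valuation `ε`. -/
structure IsCyclotomicPlace (v : Valuation K Γ₀) (q : K) (n : ℕ) (ε : Γ₀) : Prop where
  map_q : v q = 1
  ne_zero : ε ≠ 0
  le_one : ε ≤ 1
  of_not_dvd : ∀ e : ℤ, ¬ (n : ℤ) ∣ e → v (1 - q ^ e) = 1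
  of_dvd : ∀ e : ℤ, e ≠ 0 → (n : ℤ) ∣ e → v (1 - q ^ e) = ε

namespace IsCyclotomicPlace

variable {v : Valuation K Γ₀} {q : K} {n : ℕ} {ε : Γ₀}

theorem q_ne_zero (P : IsCyclotomicPlace v q n ε) : q ≠ 0 := by
  rintro rfl
  simpa using P.map_q

theorem map_zpow_pow (P : IsCyclotomicPlace v q n ε) (c : ℤ) (m : ℕ) :
    v ((q ^ n) ^ c * q ^ m) = 1 := by
  simp [P.map_q]

theorem zpow_mul_pow (P : IsCyclotomicPlace v q n ε) (c : ℤ) (m : ℕ) :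
    (q ^ n) ^ c * q ^ m = q ^ (n * c + m : ℤ) := by
  rw [zpow_add₀ P.q_ne_zero, zpow_mul, zpow_natCast, zpow_natCast]

theorem map_one_sub_zpow_mul_pow (P : IsCyclotomicPlace v q n ε) (c : ℤ) {m : ℕ} (h : ¬ n ∣ m) :
    v (1 - (q ^ n) ^ c * q ^ m) = 1 := by
  rw [P.zpow_mul_pow]
  refine P.of_not_dvd _ fun h' => h ?_
  exact_mod_cast (dvd_add_right (dvd_mul_right (n : ℤ) c)).1 h'

theorem map_one_sub_zpow_le (P : IsCyclotomicPlace v q n ε) (c : ℤ) :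
    v (1 - (q ^ n) ^ c) ≤ ε := by
  have h := P.zpow_mul_pow c 0
  rw [pow_zero, mul_one, Nat.cast_zero, add_zero] at h
  rw [h]
  rcases eq_or_ne ((n : ℤ) * c) 0 with h0 | h0
  · simp [h0]
  · exact (P.of_dvd _ h0 (dvd_mul_right _ _)).le

theorem one_sub_zpow_ne_zero (P : IsCyclotomicPlace v q n ε) {e : ℤ} (he : e ≠ 0) :
    1 - q ^ e ≠ 0 := by
  intro h
  by_cases hd : (n : ℤ) ∣ e
  · exact P.ne_zero (by rw [← P.of_dvd e he hd, h, map_zero])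
  · simpa [h] using P.of_not_dvd e hd

theorem one_sub_zpow_mul_pow_ne_zero (P : IsCyclotomicPlace v q n ε) (c : ℤ) (m : ℕ)
    (he : (n * c + m : ℤ) ≠ 0) : 1 - (q ^ n) ^ c * q ^ m ≠ 0 := by
  rw [P.zpow_mul_pow]
  exact P.one_sub_zpow_ne_zero he

theorem map_one_sub_pow (P : IsCyclotomicPlace v q n ε) {m : ℕ} (hm : m ≠ 0) :
    v (1 - q ^ m) = if n ∣ m then ε else 1 := by
  rw [← zpow_natCast]
  split_ifs with h
  · exact P.of_dvd _ (by exact_mod_cast hm) (by exact_mod_cast h)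
  · exact P.of_not_dvd _ (by exact_mod_cast h)

end IsCyclotomicPlace

end CyclotomicPlace

/-! ### The perturbed half block as a `₆φ₅` series. -/

section PerturbedTerm

variable {K : Type*} [Field K]

/-- The common ratio factor of the perturbed series, with `y` in the role of `q ^ n`: for `y = 1` it
is `(1 - q ^ (4i+2)) ^ 3 / (1 - q ^ (4i+4)) ^ 3`. -/
def perturbedRatio (q y : K) (t i : ℕ) : K :=
  ((1 - y ^ (8 * t : ℤ) * q ^ (4 * i + 2)) * (1 - y ^ (4 * t + 2 : ℤ) * q ^ (4 * i + 2)) *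
      (1 - y ^ (-2 : ℤ) * q ^ (4 * i + 2))) /
    ((1 - y ^ (0 : ℤ) * q ^ (4 * i + 4)) * (1 - y ^ (4 * t - 2 : ℤ) * q ^ (4 * i + 4)) *
      (1 - y ^ (8 * t + 2 : ℤ) * q ^ (4 * i + 4)))

/-- The `j`-th term of a terminating, summable perturbation of a block of the series. -/
def perturbedTerm (q y : K) (t j : ℕ) : K :=
  (1 + y ^ (4 * t : ℤ) * q ^ (4 * j + 1)) * (∏ i ∈ Finset.range j, perturbedRatio q y t i) * q ^ j

/-- With these parameters `e b = d`, so `d` is a square root of `A = e b d`. The factors `(1 - d p ^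
i) / (1 - e b p ^ (i + 1))` then telescope, which accounts for the extra linear factors on the two
sides. By `hN`, the terminating parameter `p ^ (-N)` is `q ^ 2 / y ^ 2`. -/
theorem wellPoisedCoeff_mul_eq {q y : K} (hq : q ≠ 0) (hy : y ≠ 0) {t N : ℕ}
    (hN : q ^ (4 * N + 2) = y ^ 2)
    (hd : ∀ j : ℕ, 1 - y ^ (4 * t : ℤ) * q ^ (4 * j + 1) ≠ 0) (j : ℕ) :
    wellPoisedCoeff (1 / (q * y ^ 2)) (q ^ 2 * y ^ (4 * t : ℤ) * y ^ 2) (y ^ (4 * t : ℤ) * q)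
        (q ^ 4) N j * (1 - y ^ (4 * t : ℤ) * q ^ (4 * j + 1)) =
      (1 - y ^ (4 * t : ℤ) * q) * (∏ i ∈ Finset.range j, perturbedRatio q y t i) * q ^ j := by
  induction j with
  | zero => simp [wellPoisedCoeff]
  | succ j ih =>
    have z1 : y ^ (8 * t : ℤ) = y ^ (4 * t : ℤ) * y ^ (4 * t : ℤ) := by
      rw [← zpow_add₀ hy]; congr 1; ring
    have z2 : y ^ (4 * t + 2 : ℤ) = y ^ (4 * t : ℤ) * y ^ 2 := by
      rw [zpow_add₀ hy, zpow_ofNat]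
    have z3 : y ^ (-2 : ℤ) = 1 / y ^ 2 := by
      rw [zpow_neg, one_div, zpow_ofNat]
    have z4 : y ^ (4 * t - 2 : ℤ) = y ^ (4 * t : ℤ) / y ^ 2 := by
      rw [zpow_sub₀ hy, zpow_ofNat]
    have z5 : y ^ (8 * t + 2 : ℤ) = y ^ (4 * t : ℤ) * y ^ (4 * t : ℤ) * y ^ 2 := by
      rw [zpow_add₀ hy, z1, zpow_ofNat]
    have hdj := hd (j + 1)
    rw [wellPoisedCoeff_succ, Finset.prod_range_succ, perturbedRatio, z1, z2, z3, z4, z5, zpow_zero]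
    generalize y ^ (4 * t : ℤ) = x at *
    generalize wellPoisedCoeff (1 / (q * y ^ 2)) (q ^ 2 * x * y ^ 2) (x * q) (q ^ 4) N j = X at *
    generalize ∏ i ∈ Finset.range j, perturbedRatio q y t i = Y at *
    have hN' : (q ^ 4) ^ N = y ^ 2 / q ^ 2 := by
      rw [eq_div_iff (pow_ne_zero 2 hq), ← hN]; ring
    have e1 : 1 - 1 / (q * y ^ 2) * (q ^ 2 * x * y ^ 2) * (x * q) * (q ^ 4) ^ j =
        1 - x * x * q ^ (4 * j + 2) := by field_simp; ring
    have e2 : 1 - q ^ 2 * x * y ^ 2 * (q ^ 4) ^ j = 1 - x * y ^ 2 * q ^ (4 * j + 2) := by ring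
    have e3 : 1 - x * q * (q ^ 4) ^ j = 1 - x * q ^ (4 * j + 1) := by ring
    have e4 : ((q ^ 4) ^ N - (q ^ 4) ^ j) * (1 / (q * y ^ 2) * q ^ 4) =
        (1 - 1 / y ^ 2 * q ^ (4 * j + 2)) * q := by rw [hN']; field_simp; ring
    have e5 : 1 - (q ^ 4) ^ (j + 1) = 1 - 1 * q ^ (4 * j + 4) := by ring
    have e6 : 1 - 1 / (q * y ^ 2) * (x * q) * (q ^ 4) ^ (j + 1) =
        1 - x / y ^ 2 * q ^ (4 * j + 4) := by field_simp; ring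
    have e7 : 1 - 1 / (q * y ^ 2) * (q ^ 2 * x * y ^ 2) * (q ^ 4) ^ (j + 1) =
        1 - x * q ^ (4 * (j + 1) + 1) := by field_simp; ring
    have e8 : 1 - 1 / (q * y ^ 2) * (q ^ 2 * x * y ^ 2) * (x * q) * (q ^ 4) ^ (N + 1 + j) =
        1 - x * x * y ^ 2 * q ^ (4 * j + 4) := by
      rw [show (q ^ 4) ^ (N + 1 + j) = (q ^ 4) ^ N * q ^ (4 * j + 4) by ring, hN']
      field_simp
    rw [mul_assoc _ (_ - _) (_ * _), e1, e2, e3, e4, e5, e6, e7, e8]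
    generalize 1 - x * x * q ^ (4 * j + 2) = A at *
    generalize 1 - x * y ^ 2 * q ^ (4 * j + 2) = B at *
    generalize 1 - 1 / y ^ 2 * q ^ (4 * j + 2) = C at *
    generalize 1 - x * q ^ (4 * j + 1) = E at *
    generalize 1 - x * q ^ (4 * (j + 1) + 1) = Z at *
    generalize 1 - 1 * q ^ (4 * j + 4) = D1 at *
    generalize 1 - x / y ^ 2 * q ^ (4 * j + 4) = D2 at *
    generalize 1 - x * x * y ^ 2 * q ^ (4 * j + 4) = D3 at *
    have e9 : A * B * E * (C * q) / (D1 * D2 * Z * D3) * Z = E * q * (A * B * C / (D1 * D2 * D3)) := by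
      rw [show D1 * D2 * Z * D3 = D1 * D2 * D3 * Z by ring, ← div_div, div_mul_cancel₀ _ hdj]
      ring
    rw [mul_assoc, e9]
    linear_combination q * (A * B * C / (D1 * D2 * D3)) * ih

theorem sum_perturbedTerm {q y : K} (hq : q ≠ 0) (hy : y ≠ 0) {t N : ℕ}
    (hN : q ^ (4 * N + 2) = y ^ 2)
    (h1 : ∀ j : ℕ, 1 - q ^ (4 * j + 4) ≠ 0)
    (h2 : ∀ j : ℕ, 1 - y ^ (4 * t - 2 : ℤ) * q ^ (4 * j + 4) ≠ 0)
    (h3 : ∀ j : ℕ, 1 - y ^ (4 * t : ℤ) * q ^ (4 * j + 1) ≠ 0)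
    (h4 : ∀ j : ℕ, 1 - y ^ (8 * t : ℤ) * q ^ (4 * j + 6) ≠ 0) :
    ∑ j ∈ Finset.range (N + 1), perturbedTerm q y t j =
      (1 + y ^ (4 * t : ℤ) * q) * ∏ i ∈ Finset.range N,
        ((1 - y ^ (8 * t : ℤ) * q ^ (4 * i + 6)) * (1 - y ^ (-2 : ℤ) * q ^ (4 * i + 3)) /
          ((1 - y ^ (4 * t - 2 : ℤ) * q ^ (4 * i + 4)) *
            (1 - y ^ (4 * t : ℤ) * q ^ (4 * i + 5)))) := by
  have z1 : y ^ (8 * t : ℤ) = y ^ (4 * t : ℤ) * y ^ (4 * t : ℤ) := by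
    rw [← zpow_add₀ hy]; congr 1; ring
  have z3 : y ^ (-2 : ℤ) = 1 / y ^ 2 := by
    rw [zpow_neg, one_div, zpow_ofNat]
  have z4 : y ^ (4 * t - 2 : ℤ) = y ^ (4 * t : ℤ) / y ^ 2 := by
    rw [zpow_sub₀ hy, zpow_ofNat]
  have hc := wellPoisedCoeff_mul_eq hq hy hN h3
  have hd0 : 1 - y ^ (4 * t : ℤ) * q ≠ 0 := by simpa using h3 0
  simp only [perturbedTerm]
  generalize perturbedRatio q y t = F at *
  rw [z1] at h4
  rw [z4] at h2
  rw [z1, z3, z4]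
  generalize y ^ (4 * t : ℤ) = x at *
  have e1 : ∀ i, 1 - 1 / (q * y ^ 2) * (q ^ 2 * x * y ^ 2) * (x * q) * (q ^ 4) ^ (i + 1) =
      1 - x * x * q ^ (4 * i + 6) := fun i => by field_simp; ring
  have e2 : ∀ i, 1 - 1 / (q * y ^ 2) * (q ^ 4) ^ (i + 1) = 1 - 1 / y ^ 2 * q ^ (4 * i + 3) :=
    fun i => by field_simp; ring
  have e3 : ∀ i, 1 - 1 / (q * y ^ 2) * (x * q) * (q ^ 4) ^ (i + 1) =
      1 - x / y ^ 2 * q ^ (4 * i + 4) := fun i => by field_simp; ring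
  have e4 : ∀ i, 1 - 1 / (q * y ^ 2) * (q ^ 2 * x * y ^ 2) * (q ^ 4) ^ (i + 1) =
      1 - x * q ^ (4 * i + 5) := fun i => by field_simp; ring
  have e5 : ∀ i, 1 - (q ^ 4) ^ (i + 1) = 1 - q ^ (4 * i + 4) := fun i => by ring
  have e6 : 1 - 1 / (q * y ^ 2) * (q ^ 2 * x * y ^ 2) * (x * q) = (1 - x * q) * (1 + x * q) := by
    field_simp; ring
  have key := wellPoised_sum (e := 1 / (q * y ^ 2)) (b := q ^ 2 * x * y ^ 2) (d := x * q)
    (pow_ne_zero 4 hq) (fun i => by rw [e5]; exact h1 i) (fun i => by rw [e3]; exact h2 i)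
    (fun i => by rw [e4]; simpa [mul_add, add_assoc] using h3 (i + 1))
    (fun i => by rw [e1]; exact h4 i) N
  simp only [e1, e2, e3, e4, e6] at key
  rw [← mul_right_inj' hd0, ← mul_assoc, ← key, Finset.mul_sum]
  refine Finset.sum_congr rfl fun j _ => ?_
  -- The very-well-poised factor is a difference of squares; `hc` absorbs one half and the other is
  -- the factor in the summand.
  rw [show 1 - 1 / (q * y ^ 2) * (q ^ 2 * x * y ^ 2) * (x * q) * ((q ^ 4) ^ j) ^ 2 =
    (1 - x * q ^ (4 * j + 1)) * (1 + x * q ^ (4 * j + 1)) by field_simp; ring]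
  linear_combination (-(1 + x * q ^ (4 * j + 1))) * hc j

end PerturbedTerm

/-! ### Valuations of terms, half blocks and blocks. -/

section BlockSums

variable {K Γ₀ : Type*} [Field K] [LinearOrderedCommGroupWithZero Γ₀]

/-- The ratio `(1 - q ^ (4i+2)) / (1 - q ^ (4i+4))` of consecutive values of
`(q²; q⁴)_i / (q⁴; q⁴)_i`. -/
def factorRatio (q : K) (i : ℕ) : K := (1 - q ^ (4 * i + 2)) / (1 - q ^ (4 * i + 4))

/-- The summand of the series, without the constant factor `1 / (1 + q)`. -/
def seriesTerm (q : K) (k : ℕ) : K :=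
  (1 + q ^ (4 * k + 1)) * (∏ i ∈ Finset.range k, factorRatio q i) ^ 3 * q ^ k

namespace IsCyclotomicPlace

variable {v : Valuation K Γ₀} {q : K} {s : ℕ} {ε : Γ₀}

theorem not_dvd_four_mul_add_four {i : ℕ} (hi : i < 2 * s + 1) : ¬ 4 * s + 3 ∣ 4 * i + 4 := by
  rintro ⟨c, hc⟩
  have : c < 2 := by by_contra! h; nlinarith
  interval_cases c <;> omega

/-- Since `4i + 5 < 2n`, only the value `n` itself is possible, and `n ≡ 3` modulo `4` excludes it.
-/
theorem not_dvd_four_mul_add_five {i : ℕ} (hi : i < 2 * s + 1) : ¬ 4 * s + 3 ∣ 4 * i + 5 := by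
  rintro ⟨c, hc⟩
  have : c < 2 := by by_contra! h; nlinarith
  interval_cases c <;> omega

theorem dvd_four_mul_add_two_iff {j t : ℕ} (hj : j < 4 * s + 3) :
    4 * s + 3 ∣ 4 * ((4 * s + 3) * t + j) + 2 ↔ j = 2 * s + 1 := by
  rw [show 4 * ((4 * s + 3) * t + j) + 2 = (4 * s + 3) * (4 * t) + (4 * j + 2) by ring,
    Nat.dvd_add_right (dvd_mul_right _ _)]
  constructor
  · rintro ⟨c, hc⟩
    have : c < 4 := by by_contra! h; nlinarith
    interval_cases c <;> omega
  · rintro rfl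
    exact ⟨2, by ring⟩

theorem dvd_four_mul_add_four_iff {j t : ℕ} (hj : j < 4 * s + 3) :
    4 * s + 3 ∣ 4 * ((4 * s + 3) * t + j) + 4 ↔ j = 4 * s + 2 := by
  rw [show 4 * ((4 * s + 3) * t + j) + 4 = (4 * s + 3) * (4 * t) + (4 * j + 4) by ring,
    Nat.dvd_add_right (dvd_mul_right _ _)]
  constructor
  · rintro ⟨c, hc⟩
    have : c < 5 := by by_contra! h; nlinarith
    interval_cases c <;> omega
  · rintro rfl
    exact ⟨4, by ring⟩

/-- Within a block, `n` divides a numerator exponent only when `4j + 2 = 2n` and a denominator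
exponent only when `4j + 4 = 4n`; this zero and this pole cancel over the whole block. -/
theorem map_factorRatio (P : IsCyclotomicPlace v q (4 * s + 3) ε) (t : ℕ) {j : ℕ}
    (hj : j < 4 * s + 3) : v (factorRatio q ((4 * s + 3) * t + j)) =
      if j = 2 * s + 1 then ε else if j = 4 * s + 2 then ε⁻¹ else 1 := by
  rw [factorRatio, map_div₀, P.map_one_sub_pow (by omega), P.map_one_sub_pow (by omega)]
  simp only [dvd_four_mul_add_two_iff hj, dvd_four_mul_add_four_iff hj]
  split_ifs
  · omega
  · simp
  · simp
  · simp

theorem map_prod_factorRatio_of_lt (P : IsCyclotomicPlace v q (4 * s + 3) ε) (t : ℕ) {j : ℕ}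
    (hj : 2 * s + 1 < j) (hj' : j < 4 * s + 3) :
    v (∏ i ∈ Finset.range j, factorRatio q ((4 * s + 3) * t + i)) = ε := by
  rw [map_prod, Finset.prod_eq_single (2 * s + 1)]
  · rw [P.map_factorRatio t (by omega), if_pos rfl]
  · intro i hi hne
    rw [Finset.mem_range] at hi
    rw [P.map_factorRatio t (by omega), if_neg hne, if_neg (by omega)]
  · intro h
    exact absurd (Finset.mem_range.2 hj) h

theorem map_prod_factorRatio_block (P : IsCyclotomicPlace v q (4 * s + 3) ε) (t : ℕ) :
    v (∏ i ∈ Finset.range (4 * s + 3), factorRatio q ((4 * s + 3) * t + i)) = 1 := by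
  rw [show 4 * s + 3 = (4 * s + 2) + 1 from rfl, Finset.prod_range_succ, map_mul]
  rw [P.map_prod_factorRatio_of_lt t (by omega) (by omega), P.map_factorRatio t (by omega),
    if_neg (by omega), if_pos rfl, mul_inv_cancel₀ P.ne_zero]

theorem map_prod_factorRatio_mul (P : IsCyclotomicPlace v q (4 * s + 3) ε) (t : ℕ) :
    v (∏ i ∈ Finset.range ((4 * s + 3) * t), factorRatio q i) = 1 := by
  induction t with
  | zero => simp
  | succ t ih =>
    rw [mul_add, mul_one, Finset.prod_range_add, map_mul, ih, one_mul,
      P.map_prod_factorRatio_block t]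

theorem map_one_add_le_one (P : IsCyclotomicPlace v q (4 * s + 3) ε) (k : ℕ) :
    v (1 + q ^ k) ≤ 1 :=
  v.map_add_le v.map_one.le (by simp [P.map_q])

theorem map_seriesTerm_le (P : IsCyclotomicPlace v q (4 * s + 3) ε) (t : ℕ) {j : ℕ}
    (hj : 2 * s + 1 < j) (hj' : j < 4 * s + 3) :
    v (seriesTerm q ((4 * s + 3) * t + j)) ≤ ε ^ 2 := by
  rw [seriesTerm, Finset.prod_range_add, map_mul, map_mul, map_pow, map_pow, map_mul,
    P.map_prod_factorRatio_mul, P.map_prod_factorRatio_of_lt t hj hj', P.map_q, one_pow, mul_one,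
    one_mul]
  exact mul_le_of_le_one_of_le (P.map_one_add_le_one _)
    (pow_le_pow_right_of_le_one' P.le_one (by norm_num))

theorem map_sum_perturbedTerm_le (P : IsCyclotomicPlace v q (4 * s + 3) ε) (t : ℕ) :
    v (∑ j ∈ Finset.range (2 * s + 2), perturbedTerm q (q ^ (4 * s + 3)) t j) ≤ ε ^ 2 := by
  have hq := P.q_ne_zero
  rw [sum_perturbedTerm (N := 2 * s + 1) hq (pow_ne_zero _ hq) (by ring)
    (fun j => by simpa using P.one_sub_zpow_mul_pow_ne_zero 0 (4 * j + 4) (by push_cast; omega))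
    (fun j => P.one_sub_zpow_mul_pow_ne_zero _ _ (fun h => by
      -- The exponent `n (4t - 2) + 4j + 4` is `2` modulo `4`, hence nonzero.
      have h4 : (4 : ℤ) ∣ 2 := ⟨(4 * s + 3) * t - 2 * s + j, by
        push_cast at h; linear_combination -h⟩
      omega))
    (fun j => P.one_sub_zpow_mul_pow_ne_zero _ _ (by positivity))
    (fun j => P.one_sub_zpow_mul_pow_ne_zero _ _ (by positivity)), map_mul, sq]
  refine mul_le_of_le_one_of_le ?_ ?_
  · refine v.map_add_le v.map_one.le ?_
    simpa using (P.map_zpow_pow (4 * t : ℤ) 1).le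
  rw [Finset.prod_div_distrib, Finset.prod_mul_distrib, Finset.prod_mul_distrib, map_div₀, map_mul,
    map_mul]
  rw [map_prod v (fun i => 1 - (q ^ (4 * s + 3)) ^ (4 * t - 2 : ℤ) * q ^ (4 * i + 4)),
    map_prod v (fun i => 1 - (q ^ (4 * s + 3)) ^ (4 * t : ℤ) * q ^ (4 * i + 5)),
    Finset.prod_eq_one fun i hi => P.map_one_sub_zpow_mul_pow _
      (not_dvd_four_mul_add_four (Finset.mem_range.1 hi)),
    Finset.prod_eq_one fun i hi => P.map_one_sub_zpow_mul_pow _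
      (not_dvd_four_mul_add_five (Finset.mem_range.1 hi)), mul_one, div_one]
  have hone : ∀ (c : ℤ) (m : ℕ), v (1 - (q ^ (4 * s + 3)) ^ c * q ^ m) ≤ 1 := fun c m =>
    Valuation.map_one_sub_le_one (P.map_zpow_pow c m).le
  have hshift : ∀ (c : ℤ) (k : ℕ),
      v (1 - (q ^ (4 * s + 3)) ^ c * q ^ ((4 * s + 3) * k)) ≤ ε := fun c k => by
    rw [pow_mul, ← zpow_natCast (q ^ (4 * s + 3)) k, ← zpow_add₀ (pow_ne_zero _ hq)]
    exact P.map_one_sub_zpow_le _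
  -- Each numerator product supplies one factor `ε`: the first at `i = 2s`, where `4i + 6 = 2n`, the
  -- second at `i = s`, where `4i + 3 = n`.
  refine mul_le_mul' ?_ ?_
  · refine Valuation.map_prod_le_of_mem (fun i _ => hone _ _)
      (Finset.mem_range.2 (Nat.lt_succ_self (2 * s))) ?_
    rw [show 4 * (2 * s) + 6 = (4 * s + 3) * 2 by ring]
    exact hshift _ _
  · refine Valuation.map_prod_le_of_mem (fun i _ => hone _ _)
      (Finset.mem_range.2 (show s < 2 * s + 1 by omega)) ?_
    simpa using hshift (-2) 1

theorem map_perturbedRatio_sub_le (P : IsCyclotomicPlace v q (4 * s + 3) ε) (t : ℕ) {i : ℕ}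
    (hi : i < 2 * s + 1) :
    v (perturbedRatio q (q ^ (4 * s + 3)) t i) ≤ 1 ∧
      v (perturbedRatio q (q ^ (4 * s + 3)) t i - factorRatio q ((4 * s + 3) * t + i) ^ 3) ≤
        ε ^ 2 := by
  have hy : q ^ (4 * s + 3) ≠ 0 := pow_ne_zero _ P.q_ne_zero
  have hx : ∀ m : ℕ, q ^ (4 * ((4 * s + 3) * t + i) + m) =
      (q ^ (4 * s + 3)) ^ (4 * t : ℤ) * q ^ (4 * i + m) := fun m => by
    rw [P.zpow_mul_pow, ← zpow_natCast]; congr 1; push_cast; ring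
  have hone : ∀ (c : ℤ) (m : ℕ), v (1 - (q ^ (4 * s + 3)) ^ c * q ^ m) ≤ 1 := fun c m =>
    Valuation.map_one_sub_le_one (P.map_zpow_pow c m).le
  have hunit : ∀ c : ℤ, v (1 - (q ^ (4 * s + 3)) ^ c * q ^ (4 * i + 4)) = 1 := fun c =>
    P.map_one_sub_zpow_mul_pow c (not_dvd_four_mul_add_four hi)
  have hden : v ((1 - (q ^ (4 * s + 3)) ^ (0 : ℤ) * q ^ (4 * i + 4)) *
      (1 - (q ^ (4 * s + 3)) ^ (4 * t - 2 : ℤ) * q ^ (4 * i + 4)) *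
      (1 - (q ^ (4 * s + 3)) ^ (8 * t + 2 : ℤ) * q ^ (4 * i + 4))) = 1 := by
    rw [map_mul, map_mul, hunit, hunit, hunit, one_mul, one_mul]
  have hnum : v ((1 - (q ^ (4 * s + 3)) ^ (8 * t : ℤ) * q ^ (4 * i + 2)) *
      (1 - (q ^ (4 * s + 3)) ^ (4 * t + 2 : ℤ) * q ^ (4 * i + 2)) *
      (1 - (q ^ (4 * s + 3)) ^ (-2 : ℤ) * q ^ (4 * i + 2))) ≤ 1 := by
    rw [map_mul, map_mul]
    exact mul_le_one' (mul_le_one' (hone _ _) (hone _ _)) (hone _ _)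
  have hu : ∀ m : ℕ, v (q ^ m) ≤ 1 := fun m => by simp [P.map_q]
  constructor
  · rw [perturbedRatio, map_div₀, hden, div_one]
    exact hnum
  · rw [factorRatio, hx, hx, div_pow, perturbedRatio]
    refine Valuation.map_div_sub_div_le hnum hden (by rw [map_pow, hunit, one_pow]) ?_ ?_
    -- The exponents of `y` balance: `8t + (4t + 2) - 2 = 3 * 4t` here, and `0 + (4t - 2) + (8t + 2)
    -- = 3 * 4t` in the denominator.
    · refine Valuation.map_prod_three_sub_cube_le P.le_one (P.map_one_sub_zpow_le _)
        (P.map_one_sub_zpow_le _) (P.map_one_sub_zpow_le _) (P.map_one_sub_zpow_le _) (hu _) ?_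
      generalize q ^ (4 * s + 3) = y at hy ⊢
      rw [← zpow_natCast, ← zpow_mul, ← zpow_add₀ hy, ← zpow_add₀ hy]
      congr 1; push_cast; ring
    · refine Valuation.map_prod_three_sub_cube_le P.le_one (P.map_one_sub_zpow_le _)
        (P.map_one_sub_zpow_le _) (P.map_one_sub_zpow_le _) (P.map_one_sub_zpow_le _) (hu _) ?_
      generalize q ^ (4 * s + 3) = y at hy ⊢
      rw [← zpow_natCast, ← zpow_mul, ← zpow_add₀ hy, ← zpow_add₀ hy]
      congr 1; push_cast; ring

theorem map_sum_seriesTerm_half_block_le (P : IsCyclotomicPlace v q (4 * s + 3) ε) (t : ℕ) :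
    v (∑ j ∈ Finset.range (2 * s + 2), seriesTerm q ((4 * s + 3) * t + j)) ≤ ε ^ 2 := by
  have hterm : ∀ j, seriesTerm q ((4 * s + 3) * t + j) =
      (∏ i ∈ Finset.range ((4 * s + 3) * t), factorRatio q i) ^ 3 * q ^ ((4 * s + 3) * t) *
        ((1 + q ^ (4 * ((4 * s + 3) * t + j) + 1)) *
          (∏ i ∈ Finset.range j, factorRatio q ((4 * s + 3) * t + i) ^ 3) * q ^ j) := fun j => by
    rw [seriesTerm, Finset.prod_range_add, Finset.prod_pow]; ring
  simp only [hterm]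
  rw [← Finset.mul_sum, map_mul, map_mul, map_pow, map_pow, P.map_prod_factorRatio_mul, P.map_q,
    one_pow, one_pow, one_mul, one_mul]
  have hsub := P.map_sum_perturbedTerm_le t
  -- The half block is the perturbed sum minus the perturbation error; the error is bounded term by
  -- term.
  refine (sub_sub_cancel (∑ j ∈ Finset.range (2 * s + 2), perturbedTerm q (q ^ (4 * s + 3)) t j)
    (∑ j ∈ Finset.range (2 * s + 2), (1 + q ^ (4 * ((4 * s + 3) * t + j) + 1)) *
      (∏ i ∈ Finset.range j, factorRatio q ((4 * s + 3) * t + i) ^ 3) * q ^ j)) ▸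
        v.map_sub_le hsub ?_
  rw [← Finset.sum_sub_distrib]
  refine v.map_sum_le fun j hj => ?_
  rw [Finset.mem_range] at hj
  have hx : q ^ (4 * ((4 * s + 3) * t + j) + 1) =
      (q ^ (4 * s + 3)) ^ (4 * t : ℤ) * q ^ (4 * j + 1) := by
    rw [P.zpow_mul_pow, ← zpow_natCast]; congr 1; push_cast; ring
  rw [perturbedTerm, hx, ← sub_mul, ← mul_sub, map_mul, map_mul, map_pow, P.map_q, one_pow, mul_one]
  refine mul_le_of_le_one_of_le (v.map_add_le v.map_one.le (P.map_zpow_pow _ _).le) ?_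
  refine Valuation.map_prod_sub_prod_le
    (fun i hi => (P.map_perturbedRatio_sub_le t (by omega)).1) (fun i hi => ?_)
    (fun i hi => (P.map_perturbedRatio_sub_le t (by omega)).2)
  rw [map_pow, P.map_factorRatio t (by omega), if_neg (by omega), if_neg (by omega), one_pow]

theorem map_sum_seriesTerm_block_le (P : IsCyclotomicPlace v q (4 * s + 3) ε) (m : ℕ) :
    v (∑ k ∈ Finset.range ((4 * s + 3) * m), seriesTerm q k) ≤ ε ^ 2 := by
  induction m with
  | zero => simp
  | succ m ih =>
    rw [mul_add, mul_one, Finset.sum_range_add]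
    refine v.map_add_le ih ?_
    rw [show 4 * s + 3 = 2 * s + 2 + (2 * s + 1) by ring, Finset.sum_range_add,
      show 2 * s + 2 + (2 * s + 1) = 4 * s + 3 by ring]
    refine v.map_add_le (P.map_sum_seriesTerm_half_block_le m) (v.map_sum_le fun j hj => ?_)
    rw [Finset.mem_range] at hj
    exact P.map_seriesTerm_le m (by omega) (by omega)

theorem map_one_add (P : IsCyclotomicPlace v q (4 * s + 3) ε) : v (1 + q) = 1 := by
  have h1 : v (1 - q ^ 1) = 1 := by
    rw [P.map_one_sub_pow one_ne_zero, if_neg]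
    intro h
    have := Nat.le_of_dvd one_pos h
    omega
  have h2 : v (1 - q ^ 2) = 1 := by
    rw [P.map_one_sub_pow two_ne_zero, if_neg]
    intro h
    have := Nat.le_of_dvd two_pos h
    omega
  rw [show 1 - q ^ 2 = (1 - q ^ 1) * (1 + q) by ring, map_mul, h1, one_mul] at h2
  exact h2

end IsCyclotomicPlace

end BlockSums

/-! ### The `Φ_n`-adic valuation on `ℚ(q)` and the final congruences. -/

open Polynomial in
theorem not_cyclotomic_dvd_X_pow_sub_one {n e : ℕ} (hn : 0 < n) (he : e ≠ 0) (h : ¬ n ∣ e) :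
    ¬ cyclotomic n ℚ ∣ X ^ e - 1 := by
  intro hd
  rw [← prod_cyclotomic_eq_X_pow_sub_one (Nat.pos_of_ne_zero he)] at hd
  obtain ⟨d, hd', hdvd⟩ := (cyclotomic.irreducible_rat hn).prime.exists_mem_finset_dvd hd
  have hne : n ≠ d := fun hnd => h (hnd ▸ Nat.dvd_of_mem_divisors hd')
  exact (cyclotomic.irreducible_rat hn).not_isUnit
    ((cyclotomic.isCoprime_rat hne).isUnit_of_dvd' dvd_rfl hdvd)

open Polynomial in
/-- The place of `ℚ(X)` given by the `n`-th cyclotomic polynomial. -/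
noncomputable def cyclotomicSpectrum (n : ℕ) (hn : 0 < n) :
    IsDedekindDomain.HeightOneSpectrum ℚ[X] :=
  .ofPrime (p := Ideal.span {cyclotomic n ℚ})
    (Ideal.prime_span_singleton_iff.2 (cyclotomic.irreducible_rat hn).prime)

open Polynomial in
theorem cyclotomicSpectrum_valuation_le_iff {n : ℕ} (hn : 0 < n) (P : ℚ[X]) (k : ℕ) :
    (cyclotomicSpectrum n hn).valuation (RatFunc ℚ) (algebraMap ℚ[X] (RatFunc ℚ) P) ≤
      WithZero.exp (-(k : ℤ)) ↔ cyclotomic n ℚ ^ k ∣ P := by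
  rw [IsDedekindDomain.HeightOneSpectrum.valuation_of_algebraMap,
    IsDedekindDomain.HeightOneSpectrum.intValuation_le_pow_iff_mem, cyclotomicSpectrum]
  change P ∈ Ideal.span {cyclotomic n ℚ} ^ k ↔ _
  rw [Ideal.span_singleton_pow, Ideal.mem_span_singleton]

/-- The denominator is a polynomial, so its valuation is at most `1` and that of the numerator is at
most that of `f`. -/
theorem cyclotomic_pow_dvd_num {n : ℕ} (hn : 0 < n) {f : RatFunc ℚ} {k : ℕ}
    (h : (cyclotomicSpectrum n hn).valuation (RatFunc ℚ) f ≤ WithZero.exp (-(k : ℤ))) :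
    Polynomial.cyclotomic n ℚ ^ k ∣ f.num := by
  rw [← cyclotomicSpectrum_valuation_le_iff hn]
  have hd := (RatFunc.algebraMap_ne_zero f.denom_ne_zero : algebraMap _ (RatFunc ℚ) f.denom ≠ 0)
  rw [← div_mul_cancel₀ (algebraMap _ (RatFunc ℚ) f.num) hd, RatFunc.num_div_denom, map_mul]
  exact mul_le_of_le_of_le_one h
    (IsDedekindDomain.HeightOneSpectrum.valuation_le_one _ _)

open Polynomial in
theorem isCyclotomicPlace_cyclotomicSpectrum {n : ℕ} (hn : 0 < n) :
    IsCyclotomicPlace ((cyclotomicSpectrum n hn).valuation (RatFunc ℚ)) RatFunc.X n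
      (WithZero.exp (-1)) := by
  set v := (cyclotomicSpectrum n hn).valuation (RatFunc ℚ) with hv
  have hle := cyclotomicSpectrum_valuation_le_iff hn
  have hunit : ∀ P : ℚ[X], ¬ cyclotomic n ℚ ∣ P → v (algebraMap ℚ[X] (RatFunc ℚ) P) = 1 := by
    intro P hP
    rw [hv, IsDedekindDomain.HeightOneSpectrum.valuation_of_algebraMap,
      IsDedekindDomain.HeightOneSpectrum.intValuation_eq_one_iff]
    change ¬ P ∈ Ideal.span {cyclotomic n ℚ}
    rwa [Ideal.mem_span_singleton]
  have hX : v RatFunc.X = 1 := by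
    rw [← RatFunc.algebraMap_X]
    refine hunit _ fun h => ?_
    obtain ⟨c, hc⟩ := h
    have h1 := cyclotomic.dvd_X_pow_sub_one n ℚ
    have h2 : cyclotomic n ℚ ∣ X ^ n := dvd_pow (Dvd.intro _ hc.symm) hn.ne'
    have h3 : cyclotomic n ℚ ∣ 1 := by simpa using dvd_sub h2 h1
    exact (cyclotomic.irreducible_rat hn).not_isUnit (isUnit_of_dvd_one h3)
  have hnat : ∀ e : ℕ, e ≠ 0 →
      v (1 - RatFunc.X ^ e) = if n ∣ e then WithZero.exp (-1) else 1 := by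
    intro e he
    have e1 : (RatFunc.X : RatFunc ℚ) ^ e - 1 = algebraMap ℚ[X] (RatFunc ℚ) (X ^ e - 1) := by
      simp
    rw [Valuation.map_sub_swap, e1]
    split_ifs with h
    · refine le_antisymm ?_ ?_
      · refine (hle _ 1).2 ?_
        rw [pow_one]
        obtain ⟨c, rfl⟩ := h
        exact (cyclotomic.dvd_X_pow_sub_one n ℚ).trans
          (by simpa [pow_mul] using sub_dvd_pow_sub_pow (X ^ n : ℚ[X]) 1 c)
      -- `X ^ e - 1` is separable in characteristic zero, so `Φ_n` divides it exactly once.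
      · have h2 : ¬ v (algebraMap ℚ[X] (RatFunc ℚ) (X ^ e - 1)) ≤ WithZero.exp (-((2 : ℕ) : ℤ)) := by
          rw [hle]
          intro h2
          have hs : Squarefree (X ^ e - 1 : ℚ[X]) :=
            (X_pow_sub_one_separable_iff.2 (by exact_mod_cast he)).squarefree
          exact (cyclotomic.irreducible_rat hn).not_isUnit (hs _ (by rwa [← sq]))
        have h0 : v (algebraMap ℚ[X] (RatFunc ℚ) (X ^ e - 1)) ≠ 0 := by
          exact fun h0 => h2 (by rw [h0]; exact zero_le)
        rw [not_le, ← WithZero.exp_log h0, WithZero.exp_lt_exp] at h2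
        rw [← WithZero.exp_log h0, WithZero.exp_le_exp]
        omega
    · exact hunit _ (not_cyclotomic_dvd_X_pow_sub_one hn he h)
  have hneg : ∀ e : ℤ, v (1 - RatFunc.X ^ e) = v (1 - RatFunc.X ^ e.natAbs) := by
    intro e
    rcases Int.natAbs_eq e with h | h
    · conv_lhs => rw [h, zpow_natCast]
    · have hX0 : (RatFunc.X : RatFunc ℚ) ≠ 0 := RatFunc.X_ne_zero
      have e2 : (1 : RatFunc ℚ) - RatFunc.X ^ e =
          -((RatFunc.X ^ e.natAbs)⁻¹ * (1 - RatFunc.X ^ e.natAbs)) := by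
        conv_lhs => rw [h, zpow_neg, zpow_natCast]
        rw [mul_sub, inv_mul_cancel₀ (pow_ne_zero _ hX0)]; ring
      rw [e2, Valuation.map_neg, map_mul, map_inv₀, map_pow, hX]; simp
  refine ⟨hX, WithZero.exp_ne_zero, ?_, fun e he => ?_, fun e he hd => ?_⟩
  · rw [← WithZero.exp_zero, WithZero.exp_le_exp]; norm_num
  · have he0 : e ≠ 0 := by rintro rfl; simp at he
    rw [hneg, hnat _ (Int.natAbs_ne_zero.2 he0), if_neg]
    rwa [← Int.natCast_dvd]
  · rw [hneg, hnat _ (Int.natAbs_ne_zero.2 he), if_pos]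
    rwa [← Int.natCast_dvd]

theorem summand_eq (k : ℕ) : summand k = (1 + RatFunc.X)⁻¹ * seriesTerm RatFunc.X k := by
  have h : ∏ i ∈ Finset.range k, factorRatio (RatFunc.X : RatFunc ℚ) i =
      qShiftedFactorial (RatFunc.X ^ 2) (RatFunc.X ^ 4) k /
        qShiftedFactorial (RatFunc.X ^ 4) (RatFunc.X ^ 4) k := by
    rw [qShiftedFactorial, qShiftedFactorial, ← Finset.prod_div_distrib]
    refine Finset.prod_congr rfl fun i _ => ?_
    rw [factorRatio]
    congr 1 <;> ring
  simp only [summand]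
  rw [seriesTerm, h, div_pow]
  generalize qShiftedFactorial (RatFunc.X ^ 2 : RatFunc ℚ) (RatFunc.X ^ 4) k = a
  generalize qShiftedFactorial (RatFunc.X ^ 4 : RatFunc ℚ) (RatFunc.X ^ 4) k = b
  rw [← div_mul_div_comm, div_eq_mul_inv _ (1 + RatFunc.X)]
  ring

theorem ratFuncModEq_sum_summand {s N : ℕ}
    (h : ∀ {v : Valuation (RatFunc ℚ) (WithZero (Multiplicative ℤ))} {ε},
      IsCyclotomicPlace v RatFunc.X (4 * s + 3) ε →
        v (∑ k ∈ Finset.range N, seriesTerm RatFunc.X k) ≤ ε ^ 2) :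
    RatFuncModEq (Polynomial.cyclotomic (4 * s + 3) ℚ ^ 2)
      (∑ k ∈ Finset.range N, summand k) 0 := by
  have hn : 0 < 4 * s + 3 := by omega
  have P := isCyclotomicPlace_cyclotomicSpectrum hn
  rw [RatFuncModEq, sub_zero]
  refine cyclotomic_pow_dvd_num hn ?_
  simp only [summand_eq]
  rw [← Finset.mul_sum, map_mul, map_inv₀, P.map_one_add, inv_one, one_mul]
  refine (h P).trans_eq ?_
  rw [← WithZero.exp_nsmul]
  rfl

theorem theorem1 (m n : ℕ) (hm : 0 < m) (hn : n % 4 = 3) :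
    RatFuncModEq (Polynomial.cyclotomic n ℚ ^ 2)
        (∑ k ∈ Finset.range (m * n), summand k) 0 ∧
      RatFuncModEq (Polynomial.cyclotomic n ℚ ^ 2)
        (∑ k ∈ Finset.range (m * n + (n - 1) / 2 + 1), summand k) 0 := by
  obtain ⟨s, rfl⟩ : ∃ s, n = 4 * s + 3 := ⟨n / 4, by omega⟩
  constructor <;> refine ratFuncModEq_sum_summand fun P => ?_
  · rw [mul_comm]
    exact P.map_sum_seriesTerm_block_le m
  · rw [mul_comm, show (4 * s + 3) * m + (4 * s + 3 - 1) / 2 + 1 =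
      (4 * s + 3) * m + (2 * s + 2) by omega, Finset.sum_range_add]
    exact Valuation.map_add_le _ (P.map_sum_seriesTerm_block_le m)
      (P.map_sum_seriesTerm_half_block_le m)
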